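/- For complex $z$ with $|z|\le 1$, $z\ne 1$, and $v\in\mathbb{C}\setminus\{0,-1,-2,\dots\}$, let $s\mapsto\Phi(z,s,v)$ be the Hurwitz-Lerch zeta function, that is, the entire function of $s$ that is the analytic continuation of the series $$\Phi(z,s,v)=\sum_{k=0}^{\infty}\frac{z^{k}}{(v+k)^{s}},\qquad \operatorname{Re}s>1,$$ with principal powers, and let $\partial_s\Phi$ denote its partial derivative with respect to $s$. Let $K=\sum_{k=0}^{\infty}\frac{(-1)^k}{(2k+1)^2}$ be Catalan's constant. Then for every positive integer $n$ the functions $s\mapsto\Phi\bigl(-e^{2i\pi j/(2n+1)},s,\tfrac12\bigr)$, $0\le j\le 2n$, are well defined (the entire continuations exist), and $$\sum_{j=0}^{2n}(-1)^j\,e^{\frac{i\pi j}{2n+1}}\;\partial_s\Phi\!\left(-e^{\frac{2i\pi j}{2n+1}},-1,\tfrac12\right)=\frac{K}{\pi}\,(-1)^n(2n+1)^2 .$$ -/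

import Mathlib

/-- `f` is the analytic continuation in `s` of the Hurwitz-Lerch series
`Φ(z, s, v) = ∑_{k ≥ 0} z ^ k (v + k) ^ (-s)`, for `|z| ≤ 1` and `v ≠ 0, -1, -2, …`.
The series converges absolutely for `Re s > 1`; the continuation is entire if `z ≠ 1`, and
analytic away from the simple pole `s = 1` if `z = 1`. As the half-plane `Re s > 1` lies in a
connected open domain, the continuation is unique on that domain. -/
structure IsLerchContinuation (z v : ℂ) (f : ℂ → ℂ) : Prop where
  differentiableOn : DifferentiableOn ℂ f {s : ℂ | z ≠ 1 ∨ s ≠ 1}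
  hasSum : ∀ s : ℂ, 1 < s.re → HasSum (fun k : ℕ => (v + (k : ℂ)) ^ (-s) * z ^ k) (f s)

open Classical in
/-- The Hurwitz-Lerch zeta function `Φ(z, s, v)` for `|z| ≤ 1` and `v ≠ 0, -1, -2, …`: the value
at `s` of the analytic continuation of the Hurwitz-Lerch series
(and `0` if there is no continuation). -/
noncomputable def hurwitzLerchZeta (z s v : ℂ) : ℂ :=
  if h : ∃ f : ℂ → ℂ, IsLerchContinuation z v f then h.choose s else 0

/-- Catalan's constant `∑_{k ≥ 0} (-1) ^ k / (2 k + 1) ^ 2`. -/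
noncomputable def catalanConstant : ℝ :=
  ∑' k : ℕ, (-1 : ℝ) ^ k / (2 * (k : ℝ) + 1) ^ 2

open Complex Filter Topology in
/-- Two entire functions that agree on the half-plane `Re s > 1` are equal. -/
theorem Differentiable.eq_of_eqOn_one_lt_re {f g : ℂ → ℂ} (hf : Differentiable ℂ f)
    (hg : Differentiable ℂ g) (h : ∀ s : ℂ, 1 < s.re → f s = g s) : f = g := by
  rw [← analyticOnNhd_univ_iff_differentiable] at hf hg
  refine hf.eq_of_eventuallyEq (z₀ := 2) hg ?_
  filter_upwards [(isOpen_lt continuous_const continuous_re).mem_nhds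
    (show (1 : ℝ) < (2 : ℂ).re by norm_num)] with s hs using h s hs

/-- The function on `ZMod N` sending odd residues `2 k + 1` to `z ^ k` and even ones to `0`. -/
noncomputable def oddPow (z : ℂ) (N : ℕ) (x : ZMod N) : ℂ :=
  if Odd x.val then z ^ (x.val / 2) else 0

theorem oddPow_natCast {z : ℂ} {M : ℕ} (hz : z ^ M = 1) (m : ℕ) :
    oddPow z (2 * M) (m : ZMod (2 * M)) = if Odd m then z ^ (m / 2) else 0 := by
  have hodd : Odd (m % (2 * M)) ↔ Odd m := by
    rw [Nat.odd_iff, Nat.odd_iff, Nat.mod_mul_right_mod]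
  rw [oddPow, ZMod.val_natCast, if_congr hodd rfl rfl, Nat.mod_mul_right_div_self,
    ← pow_eq_pow_mod _ hz]

theorem sum_oddPow {z : ℂ} {M : ℕ} [NeZero (2 * M)] (hz : z ^ M = 1) (hz1 : z ≠ 1) :
    ∑ x, oddPow z (2 * M) x = 0 := by
  have hshift (x : ZMod (2 * M)) : oddPow z (2 * M) (x + 2) = z * oddPow z (2 * M) x := by
    obtain ⟨m, rfl⟩ := ZMod.natCast_zmod_surjective x
    have hm : ((m : ZMod (2 * M)) + 2) = ((m + 2 : ℕ) : ZMod (2 * M)) := by push_cast; rfl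
    have hp : Odd (m + 2) ↔ Odd m := by simp [Nat.odd_add]
    rw [hm, oddPow_natCast hz, oddPow_natCast hz, if_congr hp rfl rfl,
      Nat.add_div_right _ two_pos, pow_succ']
    split_ifs <;> simp
  have hS : ∑ x, oddPow z (2 * M) x = z * ∑ x, oddPow z (2 * M) x := by
    rw [Finset.mul_sum, ← Fintype.sum_equiv (Equiv.addRight (2 : ZMod (2 * M))) _ _ fun x =>
      (hshift x).symm]
  have : (1 - z) * ∑ x, oddPow z (2 * M) x = 0 := by linear_combination hS
  exact (mul_eq_zero.mp this).resolve_left (sub_ne_zero.mpr hz1.symm)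

/-- For a root of unity `z ≠ 1`, the continuation of the Hurwitz-Lerch series at `v = 1 / 2` is
`2 ^ s` times the `L`-function of `oddPow z`. -/
theorem isLerchContinuation_LFunction {z : ℂ} {M : ℕ} [NeZero (2 * M)] (hz : z ^ M = 1)
    (hz1 : z ≠ 1) :
    IsLerchContinuation z (1 / 2) fun s => 2 ^ s * ZMod.LFunction (oddPow z (2 * M)) s where
  differentiableOn := by
    have h := ZMod.differentiable_LFunction_of_sum_zero (sum_oddPow hz hz1)
    exact (((differentiable_id.const_cpow (.inl two_ne_zero))).mul h).differentiableOn
  hasSum s hs := by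
    have h := (ZMod.LSeriesSummable_of_one_lt_re (oddPow z (2 * M)) hs).LSeriesHasSum
    rw [← ZMod.LFunction_eq_LSeries _ hs] at h
    have hinj : Function.Injective fun k : ℕ => 2 * k + 1 := fun a b hab => by
      simpa using hab
    have h0 : ∀ m ∉ Set.range (fun k : ℕ => 2 * k + 1),
        LSeries.term (fun m => oddPow z (2 * M) (m : ZMod (2 * M))) s m = 0 := by
      intro m hm
      have hodd : ¬ Odd m := fun ⟨k, hk⟩ => hm ⟨k, hk.symm⟩
      rw [LSeries.term_def, oddPow_natCast hz, if_neg hodd]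
      simp
    refine (((hinj.hasSum_iff h0).mpr h).mul_left (2 ^ s)).congr_fun fun k => ?_
    have hd : (2 * k + 1) / 2 = k := by omega
    have hb : ((2 * k + 1 : ℕ) : ℂ) = ((2 : ℝ) : ℂ) * ((1 / 2 + k : ℝ) : ℂ) := by
      push_cast; ring
    have hk : (1 / 2 + (k : ℂ)) = ((1 / 2 + k : ℝ) : ℂ) := by push_cast; rfl
    have h2 : (2 : ℂ) ^ s ≠ 0 := by simp [Complex.cpow_eq_zero_iff]
    rw [Function.comp_apply, LSeries.term_of_ne_zero (by omega), oddPow_natCast hz,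
      if_pos ⟨k, rfl⟩, hd, hb, Complex.mul_cpow_ofReal_nonneg (by norm_num) (by positivity), hk,
      Complex.cpow_neg]
    rw [Complex.ofReal_ofNat, mul_div_assoc', mul_div_mul_left _ _ h2,
      div_eq_mul_inv (z ^ k), mul_comm]

theorem isLerchContinuation_hurwitzLerchZeta {z v : ℂ}
    (h : ∃ f : ℂ → ℂ, IsLerchContinuation z v f) :
    IsLerchContinuation z v fun s => hurwitzLerchZeta z s v := by
  have : (fun s => hurwitzLerchZeta z s v) = h.choose := by
    funext s
    rw [hurwitzLerchZeta, dif_pos h]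
  rw [this]
  exact h.choose_spec

theorem IsLerchContinuation.differentiable {z v : ℂ} {f : ℂ → ℂ} (h : IsLerchContinuation z v f)
    (hz : z ≠ 1) : Differentiable ℂ f := by
  have := h.differentiableOn
  simpa [hz, differentiableOn_univ] using this

/-- The Dirichlet beta function, as an entire function. -/
noncomputable def dirichletBeta (s : ℂ) : ℂ := ZMod.LFunction (oddPow (-1) 4) s

theorem isLerchContinuation_dirichletBeta :
    IsLerchContinuation (-1) (1 / 2) fun s => 2 ^ s * dirichletBeta s :=
  isLerchContinuation_LFunction (M := 2) (by norm_num) (by norm_num)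

theorem differentiable_dirichletBeta : Differentiable ℂ dirichletBeta :=
  ZMod.differentiable_LFunction_of_sum_zero (sum_oddPow (M := 2) (by norm_num) (by norm_num))

theorem dirichletBeta_two : dirichletBeta 2 = catalanConstant := by
  have h := (isLerchContinuation_dirichletBeta.hasSum 2 (by norm_num)).mul_left (1 / 4)
  have h4 : (2 : ℂ) ^ (2 : ℂ) = 4 := by
    rw [Complex.cpow_ofNat]; norm_num
  rw [h4, ← mul_assoc, one_div, inv_mul_cancel₀ (by norm_num), one_mul] at h
  rw [catalanConstant, Complex.ofReal_tsum, ← h.tsum_eq]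
  refine tsum_congr fun k => ?_
  have hk : (2 * (k : ℂ) + 1) ≠ 0 := by exact_mod_cast Nat.succ_ne_zero (2 * k)
  have hk' : (1 / 2 + (k : ℂ)) = (2 * k + 1) / 2 := by ring
  rw [Complex.cpow_neg, Complex.cpow_ofNat, hk']
  push_cast
  field_simp
  norm_num

theorem oddPow_four : oddPow (-1) 4 = ![0, 1, 0, -1] := by
  funext x
  fin_cases x <;> simp [oddPow, ZMod.val, Nat.odd_iff]

theorem stdAddChar_four (x : ZMod 4) : ZMod.stdAddChar x = Complex.I ^ x.val := by
  have h1 : ZMod.stdAddChar (1 : ZMod 4) = Complex.I := by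
    have := ZMod.stdAddChar_coe (N := 4) 1
    rw [Int.cast_one] at this
    rw [this]
    refine Eq.trans (congrArg Complex.exp ?_) Complex.exp_pi_div_two_mul_I
    push_cast
    ring
  rw [← h1, ← AddChar.map_nsmul_eq_pow]
  simp

open scoped ZMod in
theorem dft_oddPow_four : 𝓕 (oddPow (-1) 4) = fun x => -2 * Complex.I * oddPow (-1) 4 x := by
  funext x
  rw [ZMod.dft_apply, oddPow_four]
  simp only [stdAddChar_four]
  refine (Fin.sum_univ_four _).trans ?_
  fin_cases x <;> simp [ZMod.val]
  · change Complex.I ^ 0 + -Complex.I ^ 0 = 0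
    ring
  · change Complex.I ^ 3 + -Complex.I ^ 1 = -(2 * Complex.I)
    rw [Complex.I_pow_three]
    ring
  · change Complex.I ^ 2 + -Complex.I ^ 2 = 0
    ring
  · change Complex.I ^ 1 + -Complex.I ^ 3 = 2 * Complex.I
    rw [Complex.I_pow_three]
    ring

open scoped ZMod in
theorem LFunction_dft_oddPow_four (s : ℂ) :
    ZMod.LFunction (𝓕 (oddPow (-1) 4)) s = -2 * Complex.I * dirichletBeta s := by
  simp only [dft_oddPow_four, dirichletBeta, ZMod.LFunction, Finset.mul_sum]
  exact Finset.sum_congr rfl fun x _ => by ring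

theorem oddPow_four_neg (x : ZMod 4) : oddPow (-1) 4 (-x) = -oddPow (-1) 4 x := by
  rw [oddPow_four]
  fin_cases x
  · exact neg_zero.symm
  all_goals simp

open scoped ZMod in
theorem LFunction_dft_oddPow_four_neg (s : ℂ) :
    ZMod.LFunction (𝓕 fun x => oddPow (-1) 4 (-x)) s = 2 * Complex.I * dirichletBeta s := by
  have : (fun x => oddPow (-1) 4 (-x)) = -oddPow (-1) 4 := funext oddPow_four_neg
  rw [this, map_neg, dft_oddPow_four]
  simp only [dirichletBeta, ZMod.LFunction, Finset.mul_sum, Pi.neg_apply]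
  exact Finset.sum_congr rfl fun x _ => by ring

open Complex in
/-- The functional equation of the Dirichlet beta function. -/
theorem dirichletBeta_one_sub {s : ℂ} (hs : ∀ n : ℕ, s ≠ -n) :
    dirichletBeta (1 - s) =
      4 ^ (s - 1) * (2 * Real.pi) ^ (-s) * Gamma s * (-2 * I * dirichletBeta s) *
        (exp (Real.pi * I * s / 2) - exp (-Real.pi * I * s / 2)) := by
  rw [dirichletBeta, ZMod.LFunction_one_sub _ hs (.inl (by simp [oddPow])),
    LFunction_dft_oddPow_four, LFunction_dft_oddPow_four_neg]
  push_cast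
  ring

open Complex in
theorem dirichletBeta_neg_one : dirichletBeta (-1) = 0 := by
  have h := dirichletBeta_one_sub (s := 2) fun n hn => by
    have := congrArg re hn
    simp at this
    linarith [Nat.cast_nonneg (α := ℝ) n]
  have h1 : exp (Real.pi * I * 2 / 2) = -1 := by
    rw [mul_div_cancel_right₀ _ two_ne_zero, exp_pi_mul_I]
  have h2 : exp (-Real.pi * I * 2 / 2) = -1 := by
    rw [mul_div_cancel_right₀ _ two_ne_zero, neg_mul, exp_neg, exp_pi_mul_I]; norm_num
  rw [h1, h2, sub_self, mul_zero] at h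
  rw [← h]; norm_num

open Complex in
theorem deriv_dirichletBeta_neg_one :
    deriv dirichletBeta (-1) = 2 * catalanConstant / Real.pi := by
  set A : ℂ → ℂ := fun s =>
    4 ^ (s - 1) * (2 * Real.pi) ^ (-s) * Gamma s * (-2 * I * dirichletBeta s) with hA
  set B : ℂ → ℂ := fun s => exp (Real.pi * I * s / 2) - exp (-Real.pi * I * s / 2) with hB
  have hpos : ∀ s : ℂ, 0 < s.re → ∀ n : ℕ, s ≠ -n := fun s hs n hn => by
    have := congrArg re hn
    simp at this
    linarith [Nat.cast_nonneg (α := ℝ) n]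
  have hpi : (Real.pi : ℂ) ≠ 0 := by exact_mod_cast Real.pi_ne_zero
  have hAd : DifferentiableAt ℂ A 2 := by
    refine DifferentiableAt.mul (DifferentiableAt.mul (DifferentiableAt.mul ?_ ?_) ?_) ?_
    · exact (differentiableAt_id.sub_const 1).const_cpow (.inl (by norm_num))
    · exact differentiableAt_id.neg.const_cpow (.inl (by simp))
    · exact differentiableAt_Gamma 2 (hpos 2 (by norm_num))
    · exact (differentiable_dirichletBeta 2).const_mul _
  have h1 : exp (Real.pi * I * 2 / 2) = -1 := by
    rw [mul_div_cancel_right₀ _ two_ne_zero, exp_pi_mul_I]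
  have h2 : exp (-Real.pi * I * 2 / 2) = -1 := by
    rw [mul_div_cancel_right₀ _ two_ne_zero, neg_mul, exp_neg, exp_pi_mul_I]; norm_num
  have hB2 : B 2 = 0 := by simp only [hB, h1, h2, sub_self]
  have hBd : HasDerivAt B (-(Real.pi * I)) 2 := by
    have e1 : HasDerivAt (fun s : ℂ => Real.pi * I * s / 2) (Real.pi * I / 2) 2 := by
      simpa using ((hasDerivAt_id (2 : ℂ)).const_mul (Real.pi * I)).div_const 2
    have e2 : HasDerivAt (fun s : ℂ => -Real.pi * I * s / 2) (-Real.pi * I / 2) 2 := by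
      simpa using ((hasDerivAt_id (2 : ℂ)).const_mul (-Real.pi * I)).div_const 2
    have e := e1.cexp.sub e2.cexp
    rw [h1, h2] at e
    refine e.congr_deriv ?_
    ring
  have hA2 : A 2 = -2 * I * catalanConstant / Real.pi ^ 2 := by
    have e1 : (4 : ℂ) ^ ((2 : ℂ) - 1) = 4 := by norm_num
    have e2 : (2 * (Real.pi : ℂ)) ^ (-(2 : ℂ)) = 1 / (4 * Real.pi ^ 2) := by
      rw [cpow_neg, cpow_ofNat]; field_simp; norm_num
    have e3 : Gamma 2 = 1 := by simp
    simp only [hA, e1, e2, e3, dirichletBeta_two]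
    field_simp
  have hAB := hAd.hasDerivAt.mul hBd
  rw [hB2, mul_zero, zero_add, hA2] at hAB
  have hcomp : HasDerivAt (fun s : ℂ => dirichletBeta (1 - s)) (-deriv dirichletBeta (-1)) 2 := by
    have e : HasDerivAt dirichletBeta (deriv dirichletBeta (-1)) (1 - 2) := by
      rw [show (1 : ℂ) - 2 = -1 by norm_num]
      exact (differentiable_dirichletBeta _).hasDerivAt
    exact (e.comp 2 ((hasDerivAt_id (2 : ℂ)).const_sub 1)).congr_deriv (by ring)
  have heq : (fun s : ℂ => dirichletBeta (1 - s)) =ᶠ[nhds 2] A * B := by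
    filter_upwards [(isOpen_lt continuous_const continuous_re).mem_nhds
      (show (0 : ℝ) < (2 : ℂ).re by norm_num)] with s hs
    exact dirichletBeta_one_sub (hpos s hs)
  have key := hcomp.unique (hAB.congr_of_eventuallyEq heq)
  rw [← neg_inj, key]
  field_simp
  rw [I_sq]
  ring

/-- Orthogonality of the `N`-th roots of unity, `N = 2 n + 1`, filters the Hurwitz-Lerch series
at `v = 1 / 2` to the indices `k ≡ n` modulo `N`. -/
theorem sum_lerch_eq {n : ℕ} {ζ : ℂ} (hζ : IsPrimitiveRoot ζ (2 * n + 1)) {f : ℕ → ℂ → ℂ}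
    (hf : ∀ j ∈ Finset.range (2 * n + 1), IsLerchContinuation (-ζ ^ j) (1 / 2) (f j))
    {s : ℂ} (hs : 1 < s.re) :
    ∑ j ∈ Finset.range (2 * n + 1), ζ ^ ((n + 1) * j) * f j s =
      (-1) ^ n * (2 * n + 1) ^ (1 - s) * (2 ^ s * dirichletBeta s) := by
  have hsum := hasSum_sum fun j hj => ((hf j hj).hasSum s hs).mul_left (ζ ^ ((n + 1) * j))
  have hterm (k : ℕ) : ∑ j ∈ Finset.range (2 * n + 1),
      ζ ^ ((n + 1) * j) * ((1 / 2 + (k : ℂ)) ^ (-s) * (-ζ ^ j) ^ k) =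
      (1 / 2 + (k : ℂ)) ^ (-s) * (-1) ^ k *
        ∑ j ∈ Finset.range (2 * n + 1), (ζ ^ (n + 1 + k)) ^ j := by
    rw [Finset.mul_sum]
    refine Finset.sum_congr rfl fun j _ => ?_
    rw [neg_pow (ζ ^ j)]
    ring
  simp only [hterm] at hsum
  have hinj : Function.Injective fun l : ℕ => n + (2 * n + 1) * l := fun a b hab => by
    simpa using hab
  rw [← hinj.hasSum_iff] at hsum
  · refine hsum.unique (((isLerchContinuation_dirichletBeta.hasSum s hs).mul_left
      ((-1 : ℂ) ^ n * (2 * n + 1) ^ (1 - s))).congr_fun fun l => ?_)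
    have hone : ζ ^ (n + 1 + (n + (2 * n + 1) * l)) = 1 := by
      rw [hζ.pow_eq_one_iff_dvd]
      exact ⟨l + 1, by ring⟩
    have hb : (1 / 2 + ((n + (2 * n + 1) * l : ℕ) : ℂ)) =
        ((2 * n + 1 : ℝ) : ℂ) * ((1 / 2 + l : ℝ) : ℂ) := by
      push_cast; ring
    have hN : (2 * (n : ℂ) + 1) ≠ 0 := by exact_mod_cast Nat.succ_ne_zero (2 * n)
    have hsign : (-1 : ℂ) ^ ((2 * n + 1) * l) = (-1) ^ l := by
      rw [pow_mul, Odd.neg_one_pow ⟨n, rfl⟩]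
    rw [Function.comp_apply, hone, hb,
      Complex.mul_cpow_ofReal_nonneg (by positivity) (by positivity), pow_add, hsign,
      sub_eq_add_neg, Complex.cpow_add _ _ hN]
    simp only [one_pow, Finset.sum_const, Finset.card_range, nsmul_eq_mul, Complex.cpow_one]
    push_cast
    ring
  · intro k hk
    have hne : ζ ^ (n + 1 + k) ≠ 1 := by
      rw [Ne, hζ.pow_eq_one_iff_dvd]
      rintro ⟨c, hc⟩
      obtain _ | c := c
      · omega
      · exact hk ⟨c, by simp only; rw [mul_add, mul_one] at hc; omega⟩
    have hg := mul_geom_sum (ζ ^ (n + 1 + k)) (2 * n + 1)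
    rw [← pow_mul, mul_comm, mul_comm (n + 1 + k), pow_mul, hζ.pow_eq_one, one_pow, sub_self] at hg
    rw [(mul_eq_zero.mp hg).resolve_right (sub_ne_zero.mpr hne), mul_zero]

theorem sum_deriv_lerch_eq {n : ℕ} {ζ : ℂ} (hζ : IsPrimitiveRoot ζ (2 * n + 1))
    {f : ℕ → ℂ → ℂ} (hne : ∀ j, -ζ ^ j ≠ 1)
    (hf : ∀ j ∈ Finset.range (2 * n + 1), IsLerchContinuation (-ζ ^ j) (1 / 2) (f j)) :
    ∑ j ∈ Finset.range (2 * n + 1), ζ ^ ((n + 1) * j) * deriv (f j) (-1) =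
      catalanConstant / Real.pi * (-1) ^ n * (2 * n + 1) ^ 2 := by
  have hN : (2 * (n : ℂ) + 1) ≠ 0 := by exact_mod_cast Nat.succ_ne_zero (2 * n)
  have hd (j) (hj : j ∈ Finset.range (2 * n + 1)) : Differentiable ℂ (f j) :=
    (hf j hj).differentiable (hne j)
  have hC : Differentiable ℂ fun s : ℂ => (-1 : ℂ) ^ n * (2 * n + 1) ^ (1 - s) * 2 ^ s :=
    (((differentiable_id.const_sub 1).const_cpow (.inl hN)).const_mul _).mul
      (differentiable_id.const_cpow (.inl two_ne_zero))
  have heq : (fun s => ∑ j ∈ Finset.range (2 * n + 1), ζ ^ ((n + 1) * j) * f j s) =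
      fun s : ℂ => ((-1) ^ n * (2 * n + 1) ^ (1 - s) * 2 ^ s) * dirichletBeta s := by
    refine Differentiable.eq_of_eqOn_one_lt_re
      (Differentiable.fun_sum fun j hj => (hd j hj).const_mul _)
      (hC.mul differentiable_dirichletBeta) fun s hs => ?_
    rw [sum_lerch_eq hζ hf hs]
    ring
  have hl : HasDerivAt (fun s => ∑ j ∈ Finset.range (2 * n + 1), ζ ^ ((n + 1) * j) * f j s)
      (∑ j ∈ Finset.range (2 * n + 1), ζ ^ ((n + 1) * j) * deriv (f j) (-1)) (-1) :=
    HasDerivAt.fun_sum fun j hj => ((hd j hj (-1)).hasDerivAt).const_mul _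
  have hr := (hC (-1)).hasDerivAt.mul (differentiable_dirichletBeta (-1)).hasDerivAt
  rw [heq] at hl
  rw [hl.unique hr, dirichletBeta_neg_one, deriv_dirichletBeta_neg_one,
    show (1 : ℂ) - -1 = 2 by norm_num, Complex.cpow_ofNat, Complex.cpow_neg_one]
  ring

theorem neg_pow_ne_one_of_odd {n : ℕ} {ζ : ℂ} (hζ : ζ ^ (2 * n + 1) = 1) (j : ℕ) :
    -ζ ^ j ≠ 1 := by
  intro h
  have h1 : (-ζ ^ j) ^ (2 * n + 1) = -1 := by
    rw [Odd.neg_pow ⟨n, rfl⟩, ← pow_mul, mul_comm, pow_mul, hζ, one_pow]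
  rw [h, one_pow] at h1
  norm_num at h1

theorem mainTheorem5 (n : ℕ) (hn : 0 < n) :
    (∀ j ∈ Finset.range (2 * n + 1),
      IsLerchContinuation (-Complex.exp (2 * Complex.I * Real.pi * j / (2 * n + 1))) (1 / 2)
        (fun s : ℂ => hurwitzLerchZeta
          (-Complex.exp (2 * Complex.I * Real.pi * j / (2 * n + 1))) s (1 / 2))) ∧
    ∑ j ∈ Finset.range (2 * n + 1),
      (-1 : ℂ) ^ j * Complex.exp (Complex.I * Real.pi * j / (2 * n + 1)) *
        deriv (fun s : ℂ => hurwitzLerchZeta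
          (-Complex.exp (2 * Complex.I * Real.pi * j / (2 * n + 1))) s (1 / 2)) (-1) =
      (catalanConstant : ℂ) / Real.pi * (-1) ^ n * (2 * n + 1) ^ 2 := by
  have hζ : IsPrimitiveRoot (Complex.exp (2 * Real.pi * Complex.I / ((2 * n + 1 : ℕ) : ℂ)))
      (2 * n + 1) := Complex.isPrimitiveRoot_exp _ (Nat.succ_ne_zero _)
  set ζ := Complex.exp (2 * Real.pi * Complex.I / ((2 * n + 1 : ℕ) : ℂ)) with hζdef
  have hN : (2 * (n : ℂ) + 1) ≠ 0 := by exact_mod_cast Nat.succ_ne_zero (2 * n)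
  have hz (j : ℕ) : Complex.exp (2 * Complex.I * Real.pi * j / (2 * n + 1)) = ζ ^ j := by
    rw [hζdef, ← Complex.exp_nat_mul]
    congr 1
    push_cast
    ring
  have hc (j : ℕ) : (-1 : ℂ) ^ j * Complex.exp (Complex.I * Real.pi * j / (2 * n + 1)) =
      ζ ^ ((n + 1) * j) := by
    rw [← Complex.exp_pi_mul_I, hζdef, ← Complex.exp_nat_mul, ← Complex.exp_nat_mul,
      ← Complex.exp_add]
    congr 1
    push_cast
    field_simp
    ring
  have hne := neg_pow_ne_one_of_odd hζ.pow_eq_one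
  have hpow (j : ℕ) : (-ζ ^ j) ^ (2 * (2 * n + 1)) = 1 := by
    rw [pow_mul, neg_sq, ← pow_mul, ← pow_mul, mul_comm, mul_comm 2, mul_assoc, pow_mul,
      hζ.pow_eq_one, one_pow]
  have hf (j : ℕ) : IsLerchContinuation (-ζ ^ j) (1 / 2)
      fun s => hurwitzLerchZeta (-ζ ^ j) s (1 / 2) :=
    isLerchContinuation_hurwitzLerchZeta ⟨_, isLerchContinuation_LFunction (hpow j) (hne j)⟩
  simp only [hz, hc]
  exact ⟨fun j _ => hf j, sum_deriv_lerch_eq hζ hne fun j _ => hf j⟩
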